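/- Let $\Omega=(a,b)$ with $-\infty<a<b<\infty$ and let $0<\alpha<1$. For $\sigma>0$ let $${}^{-}I^{\sigma}f(x)=\frac1{\Gamma(\sigma)}\int_a^x\frac{f(y)}{(x-y)^{1-\sigma}}\,dy,\qquad {}^{+}I^{\sigma}f(x)=\frac1{\Gamma(\sigma)}\int_x^b\frac{f(y)}{(y-x)^{1-\sigma}}\,dy$$ be the left ($-$) and right ($+$) Riemann--Liouville fractional integrals on $\Omega$, and for $\varphi\in C_0^\infty(\Omega)$, extended by zero to $\mathbb R$, let $${}^{-}D^{\alpha}\varphi(x)=\frac{1}{\Gamma(1-\alpha)}\frac{d}{dx}\int_{-\infty}^x\frac{\varphi(y)}{(x-y)^{\alpha}}\,dy,\qquad {}^{+}D^{\alpha}\varphi(x)=-\frac{1}{\Gamma(1-\alpha)}\frac{d}{dx}\int_x^{\infty}\frac{\varphi(y)}{(y-x)^{\alpha}}\,dy .$$ For $u\in L^1(\Omega)$, a function $v\in L^1_{loc}(\Omega)$ is the left (resp. right) weak fractional derivative ${}^{-}\mathcal D^\alpha u$ (resp. ${}^{+}\mathcal D^\alpha u$) if $\int_\Omega v\varphi\,dx=\int_\Omega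 u\,{}^{+}D^\alpha\varphi\,dx$ (resp. $\int_\Omega v\varphi\,dx=\int_\Omega u\,{}^{-}D^\alpha\varphi\,dx$) for all $\varphi\in C_0^\infty(\Omega)$. For $1\le p<\infty$ let ${}^{\pm}W^{\alpha,p}(\Omega)$ be the set of real-valued $u\in L^p(\Omega)$ for which ${}^{\pm}\mathcal D^\alpha u$ exists and lies in $L^p(\Omega)$. Put $\kappa_-^\alpha(x)=(x-a)^{\alpha-1}$, $\kappa_+^\alpha(x)=(b-x)^{\alpha-1}$ and $$c_-^{1-\alpha}=\frac{({}^{-}I^{1-\alpha}u)(a)}{\Gamma(\alpha)},\qquad c_+^{1-\alpha}=\frac{({}^{+}I^{1-\alpha}u)(b)}{\Gamma(\alpha)},$$ where the boundary values are those of the representative of ${}^{\pm}I^{1-\alpha}u$ that is continuous on $[a,b]$. Theorem (fractional Poincaré inequality). There is a constant $C=C(\alpha,\Omega)>0$ such that for all $1\le p<\infty$, for each of the signs $-$ and $+$, and for every $u\in{}^{\pm}W^{\alpha,p}(\Omega)$, the function ${}^{\pm}I^{1-\alpha}u$ has a representative continuous on $[a,b]$ (so that $c_\pm^{1-\alpha}$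 is defined) and $$\|u-c_\pm^{1-\alpha}\kappa_\pm^\alpha\|_{L^p(\Omega)}\le C\,\|{}^{\pm}\mathcal D^\alpha u\|_{L^p(\Omega)} .$$ -/

import Mathlib

open MeasureTheory Set Filter
open scoped ContDiff ENNReal

noncomputable section

/-- The left Riemann–Liouville fractional integral of order `σ > 0` on an interval `Ω`:
`(⁻I^σ f)(x) = 1/Γ(σ) ∫_{y ∈ Ω, y < x} (x - y)^(σ-1) f(y) dy`
(for `Ω = (a, b)` and `x ∈ Ω` the integral runs over `(a, x)`, for `Ω = ℝ` over `(-∞, x)`). -/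
def leftFracIntegral (Ω : Set ℝ) (σ : ℝ) (f : ℝ → ℝ) (x : ℝ) : ℝ :=
  (Real.Gamma σ)⁻¹ * ∫ y in Ω ∩ Iio x, (x - y) ^ (σ - 1) * f y

/-- The right Riemann–Liouville fractional integral of order `σ > 0` on an interval `Ω`:
`(⁺I^σ f)(x) = 1/Γ(σ) ∫_{y ∈ Ω, y > x} (y - x)^(σ-1) f(y) dy`. -/
def rightFracIntegral (Ω : Set ℝ) (σ : ℝ) (f : ℝ → ℝ) (x : ℝ) : ℝ :=
  (Real.Gamma σ)⁻¹ * ∫ y in Ω ∩ Ioi x, (y - x) ^ (σ - 1) * f y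

/-- The classical left Riemann–Liouville derivative on `ℝ`, of order `0 < α < 1`:
`⁻D^α φ = d/dx (⁻I^(1-α) φ)`. It is only applied to smooth compactly supported `φ`. -/
def leftRLDeriv (α : ℝ) (φ : ℝ → ℝ) (x : ℝ) : ℝ :=
  deriv (leftFracIntegral univ (1 - α) φ) x

/-- The classical right Riemann–Liouville derivative on `ℝ`, of order `0 < α < 1`:
`⁺D^α φ = - d/dx (⁺I^(1-α) φ)`. It is only applied to smooth compactly supported `φ`. -/
def rightRLDeriv (α : ℝ) (φ : ℝ → ℝ) (x : ℝ) : ℝ :=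
  -deriv (rightFracIntegral univ (1 - α) φ) x

/-- `φ ∈ C_0^∞(Ω)`. Such a `φ`, being a function on `ℝ`, is its own extension by zero. -/
def IsTestFunction (Ω : Set ℝ) (φ : ℝ → ℝ) : Prop :=
  ContDiff ℝ ∞ φ ∧ HasCompactSupport φ ∧ tsupport φ ⊆ Ω

/-- `v ∈ L¹_loc(Ω)` is the left weak fractional derivative `⁻𝒟^α u` of `u ∈ L¹(Ω)`, for
`0 < α < 1`. -/
def IsLeftWeakFracDeriv (Ω : Set ℝ) (α : ℝ) (u v : ℝ → ℝ) : Prop :=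
  IntegrableOn u Ω ∧ LocallyIntegrableOn v Ω ∧
    ∀ φ : ℝ → ℝ, IsTestFunction Ω φ →
      ∫ x in Ω, v x * φ x = ∫ x in Ω, u x * rightRLDeriv α φ x

/-- `v ∈ L¹_loc(Ω)` is the right weak fractional derivative `⁺𝒟^α u` of `u ∈ L¹(Ω)`, for
`0 < α < 1`. -/
def IsRightWeakFracDeriv (Ω : Set ℝ) (α : ℝ) (u v : ℝ → ℝ) : Prop :=
  IntegrableOn u Ω ∧ LocallyIntegrableOn v Ω ∧
    ∀ φ : ℝ → ℝ, IsTestFunction Ω φ →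
      ∫ x in Ω, v x * φ x = ∫ x in Ω, u x * leftRLDeriv α φ x

/-- The left fractional Sobolev space `⁻W^{α,p}(Ω)`, for `0 < α < 1`: functions `u ∈ L^p(Ω)` whose
left weak fractional derivative exists and lies in `L^p(Ω)`. -/
def leftFracSobolev (Ω : Set ℝ) (α : ℝ) (p : ℝ≥0∞) : Set (ℝ → ℝ) :=
  {u | MemLp u p (volume.restrict Ω) ∧
    ∃ v, IsLeftWeakFracDeriv Ω α u v ∧ MemLp v p (volume.restrict Ω)}

/-- The right fractional Sobolev space `⁺W^{α,p}(Ω)`, for `0 < α < 1`. -/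
def rightFracSobolev (Ω : Set ℝ) (α : ℝ) (p : ℝ≥0∞) : Set (ℝ → ℝ) :=
  {u | MemLp u p (volume.restrict Ω) ∧
    ∃ v, IsRightWeakFracDeriv Ω α u v ∧ MemLp v p (volume.restrict Ω)}

/-- The function `g`, given almost everywhere on `(a, b)`, has a representative that is continuous
on `[a, b]`, whose value at the point `t ∈ [a, b]` is `ℓ`. -/
def HasTrace (a b : ℝ) (g : ℝ → ℝ) (t ℓ : ℝ) : Prop :=
  ∃ J : ℝ → ℝ, ContinuousOn J (Icc a b) ∧ J =ᵐ[volume.restrict (Ioo a b)] g ∧ J t = ℓ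

/-- The left kernel function `κ₋^α(x) = (x - a)^(α-1)` of `(a, b)`. -/
def leftKernel (a α x : ℝ) : ℝ := (x - a) ^ (α - 1)

/-- The right kernel function `κ₊^α(x) = (b - x)^(α-1)` of `(a, b)`. -/
def rightKernel (b α x : ℝ) : ℝ := (b - x) ^ (α - 1)

/-- `c` is the constant `c₋^(1-α) = (⁻I^(1-α) u)(a) / Γ(α)` of `u`, where the boundary value is
that of the continuous representative of `⁻I^(1-α) u` on `[a, b]`. -/
def IsLeftKernelConst (a b α : ℝ) (u : ℝ → ℝ) (c : ℝ) : Prop :=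
  ∃ ℓ, HasTrace a b (leftFracIntegral (Ioo a b) (1 - α) u) a ℓ ∧ c = ℓ / Real.Gamma α

/-- `c` is the constant `c₊^(1-α) = (⁺I^(1-α) u)(b) / Γ(α)` of `u`, where the boundary value is
that of the continuous representative of `⁺I^(1-α) u` on `[a, b]`. -/
def IsRightKernelConst (a b α : ℝ) (u : ℝ → ℝ) (c : ℝ) : Prop :=
  ∃ ℓ, HasTrace a b (rightFracIntegral (Ioo a b) (1 - α) u) b ℓ ∧ c = ℓ / Real.Gamma α

end

/-! Write `I^σ` for the left fractional integral. Moving the fractional derivative off the test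
function (`integral_mul_rightRLDeriv`) shows that `v` is the ordinary weak derivative of `I^(1-α)
u`. By du Bois-Reymond (`ae_eq_const_add_primitive`), `I^(1-α) u = ℓ + ∫ₐˣ v` a.e., which gives the
continuous representative and its value `ℓ` at `a`.

Put `c = ℓ / Γ(α)`. Since `I^(1-α)` sends `c κ` to the constant `ℓ` and `I^α v` to `∫ₐˣ v`, it
annihilates `G = u - c κ - I^α v`. Applying `I^α` shows that the primitive of `G` vanishes, so `G =
0` and `u - c κ = I^α v` (`ae_eq_kernel_add_leftFracIntegral`).

On a bounded interval `I^α` is convolution with a kernel truncated to `(0, b - a)`, which is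
integrable on the line. Young's inequality bounds it on every `L^p` by the `L¹` norm of that kernel,
a constant independent of `p`. The right-sided case follows by the reflection `x ↦ a + b - x`. -/

open scoped Convolution

/-! ### Young's inequality with an integrable kernel -/

/-- Young's convolution inequality `‖f ⋆ k‖_p ≤ ‖k‖_1 ‖f‖_p`, for measurable functions. -/
theorem eLpNorm_convolution_le_of_measurable {f k : ℝ → ℝ} (hf : Measurable f) (hk : Measurable k)
    (hk1 : eLpNorm k 1 volume ≠ ⊤) {p : ℝ≥0∞} (hp1 : 1 ≤ p) (hp : p ≠ ⊤) :
    eLpNorm (f ⋆[ContinuousLinearMap.mul ℝ ℝ] k) p volume ≤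
      eLpNorm k 1 volume * eLpNorm f p volume := by
  set N := eLpNorm k 1 volume with hN
  have hp0 : p ≠ 0 := (zero_lt_one.trans_le hp1).ne'
  have hr1 : 1 ≤ p.toReal := by
    rw [← ENNReal.toReal_one]; exact ENNReal.toReal_mono hp hp1
  have hr0 : 0 < p.toReal := by linarith
  -- Hölder for the finite measure `|k| dt`, of mass `N`, compares the `L¹` and `L^p` norms of `f (x
  -- - ·)`; its `p`-th power costs the factor `N^(p-1)`. Tonelli then supplies the last factor `N`.
  set ν : Measure ℝ := volume.withDensity (fun t => ‖k t‖ₑ) with hν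
  have hνu : ν univ = N := by
    rw [hν, withDensity_apply _ MeasurableSet.univ, hN, eLpNorm_one_eq_lintegral_enorm]; simp
  have hint : ∀ g : ℝ → ℝ≥0∞, Measurable g → ∫⁻ t, g t ∂ν = ∫⁻ t, ‖k t‖ₑ * g t := by
    intro g hg
    rw [hν, lintegral_withDensity_eq_lintegral_mul _ hk.enorm hg]; rfl
  have hpt : ∀ x, ‖(f ⋆[ContinuousLinearMap.mul ℝ ℝ] k) x‖ₑ ^ p.toReal ≤
      N ^ (p.toReal - 1) * ∫⁻ t, ‖k t‖ₑ * ‖f (x - t)‖ₑ ^ p.toReal := by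
    intro x
    have h1 : ‖(f ⋆[ContinuousLinearMap.mul ℝ ℝ] k) x‖ₑ ≤ eLpNorm (fun t => f (x - t)) 1 ν := by
      rw [convolution_mul_swap, eLpNorm_one_eq_lintegral_enorm, hint _ (by fun_prop)]
      refine (enorm_integral_le_lintegral_enorm _).trans (le_of_eq ?_)
      congr 1; ext t; rw [enorm_mul, mul_comm]
    have h2 := h1.trans (eLpNorm_le_eLpNorm_mul_rpow_measure_univ (μ := ν) hp1
      (f := fun t => f (x - t)) (hf.comp (by fun_prop)).aestronglyMeasurable)
    rw [eLpNorm_eq_lintegral_rpow_enorm_toReal hp0 hp, hνu, hint _ (by fun_prop)] at h2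
    refine (ENNReal.rpow_le_rpow h2 hr0.le).trans (le_of_eq ?_)
    rw [ENNReal.mul_rpow_of_nonneg _ _ hr0.le, ← ENNReal.rpow_mul, ← ENNReal.rpow_mul,
      one_div_mul_cancel hr0.ne', ENNReal.rpow_one, mul_comm, ENNReal.toReal_one]
    congr 2
    field_simp
  have hsq : ∫⁻ x, ‖(f ⋆[ContinuousLinearMap.mul ℝ ℝ] k) x‖ₑ ^ p.toReal ≤
      N ^ p.toReal * ∫⁻ x, ‖f x‖ₑ ^ p.toReal := by
    calc _ ≤ ∫⁻ x, N ^ (p.toReal - 1) * ∫⁻ t, ‖k t‖ₑ * ‖f (x - t)‖ₑ ^ p.toReal :=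
          lintegral_mono hpt
      _ = N ^ (p.toReal - 1) * ∫⁻ x, ∫⁻ t, ‖k t‖ₑ * ‖f (x - t)‖ₑ ^ p.toReal := by
          rw [lintegral_const_mul' _ _ (ENNReal.rpow_ne_top_of_nonneg (by linarith) hk1)]
      _ = N ^ (p.toReal - 1) * ∫⁻ t, ∫⁻ x, ‖k t‖ₑ * ‖f (x - t)‖ₑ ^ p.toReal := by
          rw [lintegral_lintegral_swap (by fun_prop)]
      _ = N ^ (p.toReal - 1) * ∫⁻ t, ‖k t‖ₑ * ∫⁻ x, ‖f x‖ₑ ^ p.toReal := by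
          congr 2; ext t
          rw [lintegral_const_mul' _ _ (by finiteness),
            lintegral_sub_right_eq_self (fun x => ‖f x‖ₑ ^ p.toReal)]
      _ = N ^ p.toReal * ∫⁻ x, ‖f x‖ₑ ^ p.toReal := by
          rw [lintegral_mul_const _ hk.enorm, ← eLpNorm_one_eq_lintegral_enorm, ← hN, ← mul_assoc]
          congr 1
          conv_lhs => rw [← ENNReal.rpow_one N, ← ENNReal.rpow_mul, one_mul]
          rw [← ENNReal.rpow_add_of_nonneg _ _ (by linarith) zero_le_one, sub_add_cancel]
  rw [eLpNorm_eq_lintegral_rpow_enorm_toReal hp0 hp, eLpNorm_eq_lintegral_rpow_enorm_toReal hp0 hp]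
  refine (ENNReal.rpow_le_rpow hsq (by positivity)).trans (le_of_eq ?_)
  rw [ENNReal.mul_rpow_of_nonneg _ _ (by positivity), ← ENNReal.rpow_mul,
    mul_one_div_cancel hr0.ne', ENNReal.rpow_one]

/-- Young's convolution inequality `‖f ⋆ k‖_p ≤ ‖k‖_1 ‖f‖_p`. -/
theorem eLpNorm_convolution_le {f k : ℝ → ℝ} (hf : AEStronglyMeasurable f volume)
    (hk : Integrable k) {p : ℝ≥0∞} (hp1 : 1 ≤ p) (hp : p ≠ ⊤) :
    eLpNorm (f ⋆[ContinuousLinearMap.mul ℝ ℝ] k) p volume ≤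
      eLpNorm k 1 volume * eLpNorm f p volume := by
  have hk' := hk.aestronglyMeasurable
  rw [convolution_congr _ hf.ae_eq_mk hk'.ae_eq_mk, eLpNorm_congr_ae hf.ae_eq_mk,
    eLpNorm_congr_ae hk'.ae_eq_mk]
  refine eLpNorm_convolution_le_of_measurable hf.stronglyMeasurable_mk.measurable
    hk'.stronglyMeasurable_mk.measurable ?_ hp1 hp
  rw [← eLpNorm_congr_ae hk'.ae_eq_mk]
  exact (memLp_one_iff_integrable.2 hk).eLpNorm_ne_top

/-! ### Truncated Riemann–Liouville kernels and their semigroup identity -/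

/-- The beta integral `∫₀ᵗ s^(β-1) (t-s)^(α-1) ds = Γ(α) Γ(β)` for `α + β = 1`. -/
theorem integral_rpow_mul_sub_rpow {α β : ℝ} (hα : 0 < α) (hβ : 0 < β) (h : α + β = 1) {t : ℝ}
    (ht : 0 < t) :
    ∫ s in 0..t, s ^ (β - 1) * (t - s) ^ (α - 1) = Real.Gamma α * Real.Gamma β := by
  have h1 := Complex.betaIntegral_scaled (β : ℂ) (α : ℂ) ht
  have hαβ : (β : ℂ) + α = 1 := by rw [add_comm]; exact_mod_cast h
  have h2 := Complex.Gamma_mul_Gamma_eq_betaIntegral (s := (β : ℂ)) (t := (α : ℂ))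
    (by simpa using hβ) (by simpa using hα)
  rw [hαβ, Complex.Gamma_one, one_mul] at h2
  rw [hαβ, sub_self, Complex.cpow_zero, one_mul, ← h2] at h1
  have h3 : ∫ x in 0..t, (x : ℂ) ^ ((β : ℂ) - 1) * ((t : ℂ) - x) ^ ((α : ℂ) - 1) =
      ∫ x in 0..t, (((x ^ (β - 1) * (t - x) ^ (α - 1) : ℝ)) : ℂ) := by
    refine intervalIntegral.integral_congr fun x hx => ?_
    rw [uIcc_of_le ht.le] at hx
    push_cast
    rw [Complex.ofReal_cpow hx.1, Complex.ofReal_cpow (sub_nonneg.2 hx.2)]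
    push_cast; rfl
  rw [h3, intervalIntegral.integral_ofReal, Complex.Gamma_ofReal, Complex.Gamma_ofReal] at h1
  rw [mul_comm (Real.Gamma α)]
  exact_mod_cast h1

/-- The Riemann–Liouville kernel `t ↦ t^(σ-1) / Γ(σ)`, truncated to `(0, L)`. -/
noncomputable def fracKernel (L σ : ℝ) : ℝ → ℝ :=
  (Ioo 0 L).indicator fun t => (Real.Gamma σ)⁻¹ * t ^ (σ - 1)

theorem integrable_fracKernel (L : ℝ) {σ : ℝ} (hσ : 0 < σ) : Integrable (fracKernel L σ) := by
  rw [fracKernel, integrable_indicator_iff measurableSet_Ioo]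
  refine Integrable.const_mul ?_ _
  rcases le_total L 0 with hL | hL
  · simp [Ioo_eq_empty_of_le hL]
  · exact ((intervalIntegrable_iff_integrableOn_Ioo_of_le hL).1
      (intervalIntegral.intervalIntegrable_rpow' (by linarith)))

/-- The beta integral cancels both Gamma factors. For `t < L` the truncations are invisible, because
`s` and `t - s` both lie in `(0, t)` wherever the integrand is nonzero. -/
theorem convolution_fracKernel {L α β t : ℝ} (hα : 0 < α) (hβ : 0 < β) (h : α + β = 1)
    (ht : t < L) :
    (fracKernel L β ⋆[ContinuousLinearMap.mul ℝ ℝ] fracKernel L α) t =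
      (Ioi 0).indicator 1 t := by
  have key : ∀ s, fracKernel L β s * fracKernel L α (t - s) = (Ioo 0 t).indicator
      (fun s => (Real.Gamma α * Real.Gamma β)⁻¹ * (s ^ (β - 1) * (t - s) ^ (α - 1))) s := by
    intro s
    simp only [fracKernel, indicator_apply, mem_Ioo]
    split_ifs <;> first | (exfalso; grind) | (rw [mul_inv]; ring) | simp
  rw [convolution_mul]
  simp_rw [key]
  rw [integral_indicator measurableSet_Ioo]
  by_cases ht0 : 0 < t
  · rw [integral_const_mul, ← integral_Ioc_eq_integral_Ioo,
      ← intervalIntegral.integral_of_le ht0.le, integral_rpow_mul_sub_rpow hα hβ h ht0,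
      indicator_of_mem (by exact ht0)]
    have := (Real.Gamma_pos_of_pos hα).ne'
    have := (Real.Gamma_pos_of_pos hβ).ne'
    simp; field_simp
  · rw [Ioo_eq_empty_of_le (not_lt.1 ht0), indicator_of_notMem (by simpa using ht0)]; simp

/-- The semigroup identity `I^α I^β = I^1`, for `α + β = 1`. -/
theorem ae_convolution_fracKernel_convolution {a b α β : ℝ} (hα : 0 < α) (hβ : 0 < β)
    (h : α + β = 1) {F : ℝ → ℝ} (hF : Integrable F) (hsupp : ∀ x ≤ a, F x = 0) :
    ∀ᵐ x, x ∈ Ioo a b →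
      ((F ⋆[ContinuousLinearMap.mul ℝ ℝ] fracKernel (b - a) β)
        ⋆[ContinuousLinearMap.mul ℝ ℝ] fracKernel (b - a) α) x = ∫ y in a..x, F y := by
  have hg := integrable_fracKernel (b - a) hβ
  have hk := integrable_fracKernel (b - a) hα
  have h1 := (hg.norm.integrable_convolution (ContinuousLinearMap.mul ℝ ℝ) hk.norm)
  filter_upwards [hF.norm.ae_convolution_exists (ContinuousLinearMap.mul ℝ ℝ) h1] with x hx hxab
  -- Associativity needs absolute convergence, hence only almost every `x`. It leaves `F` convolved
  -- with a Heaviside function.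
  rw [convolution_assoc _ _ (ContinuousLinearMap.mul ℝ ℝ) (ContinuousLinearMap.mul ℝ ℝ)
    (fun x y z => by simp [mul_assoc])
    hF.aestronglyMeasurable hg.aestronglyMeasurable hk.aestronglyMeasurable
    (hF.ae_convolution_exists _ hg) (hg.norm.ae_convolution_exists _ hk.norm) hx, convolution_mul]
  -- The kernel identity is available only for `x - y < b - a`, that is, when `y > a` for every `x <
  -- b`; for `y ≤ a` the factor `F y` vanishes.
  have key : ∀ y, F y * (fracKernel (b - a) β ⋆[ContinuousLinearMap.mul ℝ ℝ]
      fracKernel (b - a) α) (x - y) = (Ioo a x).indicator F y := by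
    intro y
    rcases lt_or_ge a y with hy | hy
    · rw [convolution_fracKernel hα hβ h (by linarith [hxab.2])]
      simp only [indicator_apply, mem_Ioo, mem_Ioi]
      split_ifs <;> first | (exfalso; grind) | simp
    · simp [indicator_apply, hsupp y hy]
  simp_rw [key]
  rw [integral_indicator measurableSet_Ioo, intervalIntegral.integral_of_le hxab.1.le,
    integral_Ioc_eq_integral_Ioo]

/-! ### Test functions, du Bois-Reymond and primitives -/

theorem IsCompact.exists_subset_Icc_of_subset_Ioo {K : Set ℝ} (hK : IsCompact K) {a b : ℝ}
    (hab : a < b) (h : K ⊆ Ioo a b) : ∃ c d, a < c ∧ d < b ∧ K ⊆ Icc c d := by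
  rcases K.eq_empty_or_nonempty with rfl | hne
  · exact ⟨b, a, hab, hab, empty_subset _⟩
  · obtain ⟨c, hc⟩ := hK.exists_isLeast hne
    obtain ⟨d, hd⟩ := hK.exists_isGreatest hne
    exact ⟨c, d, (h hc.1).1, (h hd.1).2, fun x hx => ⟨hc.2 hx, hd.2 hx⟩⟩

theorem IsTestFunction.continuous {Ω : Set ℝ} {φ : ℝ → ℝ} (h : IsTestFunction Ω φ) :
    Continuous φ := h.1.continuous

theorem IsTestFunction.integrable {Ω : Set ℝ} {φ : ℝ → ℝ} (h : IsTestFunction Ω φ) :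
    Integrable φ := h.continuous.integrable_of_hasCompactSupport h.2.1

theorem IsTestFunction.eq_zero {Ω : Set ℝ} {φ : ℝ → ℝ} (h : IsTestFunction Ω φ) {x : ℝ}
    (hx : x ∉ Ω) : φ x = 0 :=
  image_eq_zero_of_notMem_tsupport fun h' => hx (h.2.2 h')

theorem IsTestFunction.deriv {Ω : Set ℝ} {φ : ℝ → ℝ} (h : IsTestFunction Ω φ) :
    IsTestFunction Ω (deriv φ) :=
  ⟨(contDiff_infty_iff_deriv.1 h.1).2, h.2.1.deriv, (closure_minimal (support_deriv_subset)
    (isClosed_tsupport _)).trans h.2.2⟩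

theorem IsTestFunction.sub_const_mul {Ω : Set ℝ} {φ ψ : ℝ → ℝ} (hφ : IsTestFunction Ω φ)
    (hψ : IsTestFunction Ω ψ) (c : ℝ) : IsTestFunction Ω (fun x => φ x - c * ψ x) := by
  have hsub : Function.support (fun x => φ x - c * ψ x) ⊆ tsupport φ ∪ tsupport ψ := by
    intro x hx
    by_contra hx'
    rw [mem_union, not_or] at hx'
    exact hx (by simp [image_eq_zero_of_notMem_tsupport hx'.1,
      image_eq_zero_of_notMem_tsupport hx'.2])
  have hK : IsCompact (tsupport φ ∪ tsupport ψ) := hφ.2.1.isCompact.union hψ.2.1.isCompact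
  exact ⟨hφ.1.sub (contDiff_const.mul hψ.1), HasCompactSupport.of_support_subset_isCompact hK hsub,
    (closure_minimal hsub hK.isClosed).trans (union_subset hφ.2.2 hψ.2.2)⟩

/-- A test function on an interval with vanishing integral is the derivative of a test function. -/
theorem IsTestFunction.exists_deriv_eq {a b : ℝ} (hab : a < b) {θ : ℝ → ℝ}
    (hθ : IsTestFunction (Ioo a b) θ) (h0 : ∫ x, θ x = 0) :
    ∃ Φ, IsTestFunction (Ioo a b) Φ ∧ _root_.deriv Φ = θ := by
  obtain ⟨c, d, hac, hdb, hcd⟩ := hθ.2.1.isCompact.exists_subset_Icc_of_subset_Ioo hab hθ.2.2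
  have hd : ∀ x, HasDerivAt (fun x => ∫ t in a..x, θ t) (θ x) x := fun x =>
    (hθ.continuous.integral_hasStrictDerivAt a x).hasDerivAt
  have hderiv : _root_.deriv (fun x => ∫ t in a..x, θ t) = θ := funext fun x => (hd x).deriv
  have hzero : ∀ t, t ∉ Icc c d → θ t = 0 := fun t ht =>
    image_eq_zero_of_notMem_tsupport fun h' => ht (hcd h')
  have hsub : Function.support (fun x => ∫ t in a..x, θ t) ⊆ Icc c d := by
    intro x hx
    by_contra hx'
    refine hx ?_
    rcases lt_or_ge x c with hxc | hxc
    · refine intervalIntegral.integral_zero_ae (.of_forall fun t ht => hzero t fun h' => ?_)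
      exact (lt_of_le_of_lt ht.2 (max_lt hac hxc)).not_ge h'.1
    · have hdx : d < x := by
        by_contra hdx
        exact hx' ⟨hxc, not_lt.1 hdx⟩
      -- To the right of the support the primitive equals the full integral, which is zero.
      show ∫ t in a..x, θ t = 0
      rw [intervalIntegral.integral_eq_integral_of_support_subset, h0]
      intro t ht
      have : t ∈ Icc c d := by
        by_contra h'
        exact ht (hzero t h')
      exact ⟨hac.trans_le this.1, this.2.trans hdx.le⟩
  refine ⟨fun x => ∫ t in a..x, θ t, ⟨?_, HasCompactSupport.of_support_subset_isCompact
    isCompact_Icc hsub, (closure_minimal hsub isClosed_Icc).trans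
      fun x hx => ⟨hac.trans_le hx.1, hx.2.trans_lt hdb⟩⟩, hderiv⟩
  rw [contDiff_infty_iff_deriv, hderiv]
  exact ⟨fun x => (hd x).differentiableAt, hθ.1⟩

theorem exists_isTestFunction_integral_eq_one {a b : ℝ} (hab : a < b) :
    ∃ ψ, IsTestFunction (Ioo a b) ψ ∧ ∫ x, ψ x = 1 := by
  let f : ContDiffBump ((a + b) / 2) := ⟨(b - a) / 8, (b - a) / 4, by linarith, by linarith⟩
  refine ⟨f.normed volume, ⟨f.contDiff_normed, f.hasCompactSupport_normed, ?_⟩, f.integral_normed⟩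
  rw [f.tsupport_normed_eq, Real.closedBall_eq_Icc]
  intro x hx
  have h1 : (a + b) / 2 - (b - a) / 4 ≤ x := hx.1
  have h2 : x ≤ (a + b) / 2 + (b - a) / 4 := hx.2
  constructor <;> linarith

theorem IntegrableOn.mul_isTestFunction {s Ω : Set ℝ} {g φ : ℝ → ℝ} (hg : IntegrableOn g s)
    (hφ : IsTestFunction Ω φ) : IntegrableOn (fun x => g x * φ x) s := by
  obtain ⟨C, hC⟩ := hφ.2.1.exists_bound_of_continuous hφ.continuous
  exact hg.mul_bdd (c := C) hφ.continuous.aestronglyMeasurable (.of_forall hC)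

/-- The lemma of du Bois-Reymond: a function with vanishing weak derivative is constant. -/
theorem ae_eq_const_of_integral_mul_deriv_eq_zero {a b : ℝ} (hab : a < b) {g : ℝ → ℝ}
    (hg : IntegrableOn g (Ioo a b))
    (h : ∀ φ, IsTestFunction (Ioo a b) φ → ∫ x in Ioo a b, g x * deriv φ x = 0) :
    ∃ c, ∀ᵐ x, x ∈ Ioo a b → g x = c := by
  -- Subtracting `(∫ φ) ψ` from a test function `φ` makes its mean zero, hence makes it the
  -- derivative of a test function. So `∫ g φ = c ∫ φ` with `c = ∫ g ψ`.
  obtain ⟨ψ, hψ, hψ1⟩ := exists_isTestFunction_integral_eq_one hab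
  set c := ∫ x in Ioo a b, g x * ψ x with hc
  refine ⟨c, ?_⟩
  have hgc : IntegrableOn (fun x => g x - c) (Ioo a b) :=
    hg.sub (integrableOn_const (by simp) (by simp))
  have key := isOpen_Ioo.ae_eq_zero_of_integral_contDiff_smul_eq_zero hgc.locallyIntegrableOn ?_
  · filter_upwards [key] with x hx hxab
    linarith [hx hxab]
  intro φ hφ1 hφ2 hφ3
  have hφ : IsTestFunction (Ioo a b) φ := ⟨hφ1, hφ2, hφ3⟩
  have hI : ∫ x in Ioo a b, φ x = ∫ x, φ x :=
    setIntegral_eq_integral_of_forall_compl_eq_zero fun x hx => hφ.eq_zero hx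
  obtain ⟨Φ, hΦ, hΦd⟩ := (hφ.sub_const_mul hψ (∫ x, φ x)).exists_deriv_eq hab (by
    rw [integral_sub hφ.integrable (hψ.integrable.const_mul _), integral_const_mul, hψ1]; simp)
  have h1 := h Φ hΦ
  have hgφ := IntegrableOn.mul_isTestFunction hg hφ
  have hgψ := IntegrableOn.mul_isTestFunction hg hψ
  have h2 : ∫ x in Ioo a b, (g x * φ x - (∫ x, φ x) * (g x * ψ x)) = 0 := by
    rw [← h1, hΦd]; congr 1; ext x; ring
  rw [integral_sub hgφ (hgψ.const_mul _), integral_const_mul, ← hc] at h2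
  rw [← setIntegral_eq_integral_of_forall_compl_eq_zero (s := Ioo a b)
    fun x hx => by simp [hφ.eq_zero hx]]
  have h3 : ∫ x in Ioo a b, φ x • (g x - c) = ∫ x in Ioo a b, (g x * φ x - c * φ x) := by
    congr 1; ext x; simp; ring
  rw [h3, integral_sub hgφ (hφ.integrable.integrableOn.const_mul _), integral_const_mul, hI]
  linarith

/-- Integration by parts for an absolutely continuous primitive, whose derivative is `v` a.e.; the
boundary terms vanish with `φ`. -/
theorem integral_primitive_mul_deriv {a b : ℝ} (hab : a < b) {v φ : ℝ → ℝ}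
    (hv : IntegrableOn v (Ioo a b)) (hφ : IsTestFunction (Ioo a b) φ) :
    ∫ x in Ioo a b, (∫ t in a..x, v t) * deriv φ x = -∫ x in Ioo a b, v x * φ x := by
  have hvi : IntervalIntegrable v volume a b :=
    (intervalIntegrable_iff_integrableOn_Ioo_of_le hab.le).2 hv
  have h1 := (hvi.absolutelyContinuousOnInterval_intervalIntegral
    (left_mem_uIcc)).integral_mul_deriv_eq_deriv_mul
    ((hφ.1.of_le (by simp)).contDiffOn.absolutelyContinuousOnInterval (f := φ) (a := a) (b := b))
  rw [hφ.eq_zero (x := a) (by simp), hφ.eq_zero (x := b) (by simp)] at h1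
  have h2 : ∫ x in a..b, deriv (fun x => ∫ t in a..x, v t) x * φ x = ∫ x in a..b, v x * φ x := by
    refine intervalIntegral.integral_congr_ae ?_
    filter_upwards [hvi.ae_hasDerivAt_integral] with x hx hxab
    rw [(hx (uIoc_subset_uIcc hxab) a left_mem_uIcc).deriv]
  rwa [h2, mul_zero, mul_zero, sub_zero, zero_sub, intervalIntegral.integral_of_le hab.le,
    intervalIntegral.integral_of_le hab.le, integral_Ioc_eq_integral_Ioo,
    integral_Ioc_eq_integral_Ioo] at h1

/-- A function with integrable weak derivative `v` is a.e. equal to a constant plus `∫ₐˣ v`. -/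
theorem ae_eq_const_add_primitive {a b : ℝ} (hab : a < b) {w v : ℝ → ℝ}
    (hw : IntegrableOn w (Ioo a b)) (hv : IntegrableOn v (Ioo a b))
    (h : ∀ φ, IsTestFunction (Ioo a b) φ →
      ∫ x in Ioo a b, v x * φ x = -∫ x in Ioo a b, w x * deriv φ x) :
    ∃ c, ∀ᵐ x, x ∈ Ioo a b → w x = c + ∫ t in a..x, v t := by
  have hJ : IntegrableOn (fun x => ∫ t in a..x, v t) (Ioo a b) := by
    refine IntegrableOn.mono_set ?_ Ioo_subset_Icc_self
    refine ContinuousOn.integrableOn_Icc ?_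
    exact intervalIntegral.continuousOn_primitive_interval (by
      rw [uIcc_of_le hab.le]; exact (integrableOn_Icc_iff_integrableOn_Ioo (by simp) (by simp)).2 hv) |>.mono
      (by rw [uIcc_of_le hab.le])
  obtain ⟨c, hc⟩ := ae_eq_const_of_integral_mul_deriv_eq_zero hab (hw.sub hJ) (by
    intro φ hφ
    simp only [Pi.sub_apply, sub_mul]
    rw [integral_sub (IntegrableOn.mul_isTestFunction hw hφ.deriv)
      (IntegrableOn.mul_isTestFunction hJ hφ.deriv), integral_primitive_mul_deriv hab hv hφ, h φ hφ]
    ring)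
  refine ⟨c, ?_⟩
  filter_upwards [hc] with x hx hxab
  have := hx hxab
  simp only [Pi.sub_apply] at this
  linarith

/-! ### Fractional integrals as convolutions, and fractional integration by parts -/

theorem fracKernel_of_nonpos {L σ t : ℝ} (ht : t ≤ 0) : fracKernel L σ t = 0 :=
  indicator_of_notMem (fun h => ht.not_gt h.1) _

/-- If `a < y < x ≤ b`, then `0 < x - y < b - a`, so the truncated kernel agrees with the true one.
-/
theorem leftFracIntegral_eq_convolution {a b σ x : ℝ} (hx : x ≤ b) (f : ℝ → ℝ) :
    leftFracIntegral (Ioo a b) σ f x =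
      ((Ioo a b).indicator f ⋆[ContinuousLinearMap.mul ℝ ℝ] fracKernel (b - a) σ) x := by
  have key : ∀ y, (Ioo a b).indicator f y * fracKernel (b - a) σ (x - y) =
      (Ioo a b ∩ Iio x).indicator (fun y => (Real.Gamma σ)⁻¹ * ((x - y) ^ (σ - 1) * f y)) y := by
    intro y
    simp only [fracKernel, indicator_apply, mem_inter_iff, mem_Ioo, mem_Iio]
    split_ifs <;> first | (exfalso; grind) | ring
  rw [convolution_mul, leftFracIntegral]
  simp_rw [key]
  rw [integral_indicator (measurableSet_Ioo.inter measurableSet_Iio), integral_const_mul]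

/-- The right fractional integral is convolution with the reflected kernel, and the derivative can
be put on the smooth factor `φ`. Truncation is harmless only to the right of `a`, which suffices
because differentiation is local. -/
theorem rightRLDeriv_eq_integral {a b α : ℝ} (hα1 : α < 1) {φ : ℝ → ℝ}
    (hφ : IsTestFunction (Ioo a b) φ) {x : ℝ} (hx : a < x) :
    rightRLDeriv α φ x = -∫ t, fracKernel (b - a) (1 - α) (t - x) * deriv φ t := by
  set K : ℝ → ℝ := fun t => fracKernel (b - a) (1 - α) (-t) with hK
  have hKi : Integrable K := (integrable_fracKernel (b - a) (by linarith)).comp_neg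
  have hEq : ∀ z, a < z → rightFracIntegral univ (1 - α) φ z =
      (K ⋆[ContinuousLinearMap.mul ℝ ℝ] φ) z := by
    intro z hz
    have key : ∀ y, K (z - y) * φ y = (univ ∩ Ioi z).indicator
        (fun y => (Real.Gamma (1 - α))⁻¹ * ((y - z) ^ (1 - α - 1) * φ y)) y := by
      intro y
      by_cases hy : y ∈ Ioo a b
      · simp only [hK, fracKernel, indicator_apply, mem_inter_iff, mem_Ioo, mem_Ioi, mem_univ,
          true_and, neg_sub] at hy ⊢
        split_ifs <;> first | (exfalso; grind) | ring
      · simp [indicator_apply, hφ.eq_zero hy]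
    rw [convolution_mul_swap, rightFracIntegral]
    simp_rw [key]
    rw [integral_indicator (MeasurableSet.univ.inter measurableSet_Ioi), integral_const_mul]
  have hev : rightFracIntegral univ (1 - α) φ =ᶠ[nhds x] (K ⋆[ContinuousLinearMap.mul ℝ ℝ] φ) :=
    by
    filter_upwards [isOpen_Ioi.mem_nhds (show x ∈ Ioi a from hx)] with z hz using hEq z hz
  rw [rightRLDeriv, hev.deriv_eq,
    (hφ.2.1.hasDerivAt_convolution_right _ hKi.locallyIntegrable (hφ.1.of_le (by simp)) x).deriv,
    convolution_mul_swap]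
  simp [hK]

/-- Fractional integration by parts against a test function. -/
theorem integral_mul_rightRLDeriv {a b α : ℝ} (hα1 : α < 1) {u φ : ℝ → ℝ}
    (hu : IntegrableOn u (Ioo a b)) (hφ : IsTestFunction (Ioo a b) φ) :
    ∫ x in Ioo a b, u x * rightRLDeriv α φ x =
      -∫ x in Ioo a b, leftFracIntegral (Ioo a b) (1 - α) u x * deriv φ x := by
  set F := (Ioo a b).indicator u with hF
  set K := fracKernel (b - a) (1 - α) with hK
  have hFi : Integrable F := (integrable_indicator_iff measurableSet_Ioo).2 hu
  have hKi : Integrable K := integrable_fracKernel (b - a) (by linarith)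
  obtain ⟨C, hC⟩ := hφ.deriv.2.1.exists_bound_of_continuous hφ.deriv.continuous
  -- Justifies Fubini: an integrable convolution integrand times the bounded function `φ'`.
  have hint : Integrable (fun p : ℝ × ℝ => F p.2 * K (p.1 - p.2) * deriv φ p.1)
      (volume.prod volume) :=
    (hFi.convolution_integrand (ContinuousLinearMap.mul ℝ ℝ) hKi).mul_bdd (c := C)
      (hφ.deriv.continuous.comp continuous_fst).aestronglyMeasurable (.of_forall fun p => hC _)
  calc ∫ x in Ioo a b, u x * rightRLDeriv α φ x
      = ∫ x in Ioo a b, -∫ t, F x * K (t - x) * deriv φ t := by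
        refine setIntegral_congr_fun measurableSet_Ioo fun x hx => ?_
        rw [rightRLDeriv_eq_integral hα1 hφ hx.1, hF, indicator_of_mem hx, mul_neg,
          ← integral_const_mul]
        simp only [mul_assoc, hK]
    _ = -∫ x, ∫ t, F x * K (t - x) * deriv φ t := by
        rw [integral_neg, setIntegral_eq_integral_of_forall_compl_eq_zero]
        intro x hx
        simp [hF, indicator_of_notMem hx]
    _ = -∫ t, ∫ x, F x * K (t - x) * deriv φ t := by
        rw [integral_integral_swap (f := fun x t => F x * K (t - x) * deriv φ t) hint.swap]
    _ = -∫ t, (F ⋆[ContinuousLinearMap.mul ℝ ℝ] K) t * deriv φ t := by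
        simp_rw [integral_mul_const, convolution_mul]
    _ = -∫ x in Ioo a b, leftFracIntegral (Ioo a b) (1 - α) u x * deriv φ x := by
        rw [← setIntegral_eq_integral_of_forall_compl_eq_zero (s := Ioo a b)
          fun x hx => by simp [hφ.deriv.eq_zero hx]]
        congr 1
        refine setIntegral_congr_fun measurableSet_Ioo fun x hx => ?_
        rw [leftFracIntegral_eq_convolution hx.2.le]

theorem integrableOn_leftFracIntegral {a b σ : ℝ} (hσ : 0 < σ) {f : ℝ → ℝ}
    (hf : IntegrableOn f (Ioo a b)) :
    IntegrableOn (leftFracIntegral (Ioo a b) σ f) (Ioo a b) :=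
  (((integrable_indicator_iff measurableSet_Ioo).2 hf).integrable_convolution
    (ContinuousLinearMap.mul ℝ ℝ) (integrable_fracKernel (b - a) hσ)).integrableOn.congr_fun
    (fun _ hx => (leftFracIntegral_eq_convolution hx.2.le f).symm) measurableSet_Ioo

/-! ### Inverting the fractional integral -/

/-- Causality: the kernel lives on positive arguments, so the value at `x` sees only `H` on `(-∞,
x)`. It serves at both endpoints: functions vanishing left of `a`, and identities known only left of
`b`. -/
theorem convolution_fracKernel_eq_zero {L σ b x : ℝ} {H : ℝ → ℝ} (hx : x ≤ b)
    (hH : ∀ᵐ y, y < b → H y = 0) :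
    (H ⋆[ContinuousLinearMap.mul ℝ ℝ] fracKernel L σ) x = 0 := by
  rw [convolution_mul]
  refine integral_eq_zero_of_ae ?_
  filter_upwards [hH] with y hy
  rcases lt_or_ge y b with h | h
  · simp [hy h]
  · simp [fracKernel_of_nonpos (show x - y ≤ 0 by linarith)]

/-- An integrable function whose primitive vanishes a.e. vanishes a.e. -/
theorem ae_eq_zero_of_ae_primitive_eq_zero {a b : ℝ} (hab : a < b) {G : ℝ → ℝ} (hG : Integrable G)
    (h : ∀ᵐ x, x ∈ Ioo a b → ∫ t in a..x, G t = 0) : ∀ᵐ x, x ∈ Ioo a b → G x = 0 := by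
  refine isOpen_Ioo.ae_eq_zero_of_integral_contDiff_smul_eq_zero hG.integrableOn.locallyIntegrableOn
    fun φ h1 h2 h3 => ?_
  have hφ : IsTestFunction (Ioo a b) φ := ⟨h1, h2, h3⟩
  have key := integral_primitive_mul_deriv hab hG.integrableOn hφ
  rw [setIntegral_congr_ae (g := fun _ => 0) measurableSet_Ioo
    (h.mono fun x hx hxab => by simp [hx hxab]), integral_zero] at key
  rw [← setIntegral_eq_integral_of_forall_compl_eq_zero (s := Ioo a b)
    fun x hx => by simp [hφ.eq_zero hx]]
  simp_rw [smul_eq_mul, mul_comm (φ _)]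
  linarith

/-- If `I^(1-α) u = c + ∫ₐˣ v`, then `u = (c / Γ(α)) κ + I^α v`. -/
theorem ae_eq_kernel_add_leftFracIntegral {a b α c : ℝ} (hab : a < b) (hα0 : 0 < α) (hα1 : α < 1)
    {u v : ℝ → ℝ} (hu : IntegrableOn u (Ioo a b)) (hv : IntegrableOn v (Ioo a b))
    (h : ∀ᵐ x, x ∈ Ioo a b →
      leftFracIntegral (Ioo a b) (1 - α) u x = c + ∫ t in a..x, v t) :
    ∀ᵐ x, x ∈ Ioo a b →
      u x - c / Real.Gamma α * leftKernel a α x = leftFracIntegral (Ioo a b) α v x := by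
  have hβ : 0 < 1 - α := by linarith
  set F := (Ioo a b).indicator u with hF
  set V := (Ioo a b).indicator v with hV
  set A := fracKernel (b - a) α with hA
  set B := fracKernel (b - a) (1 - α) with hB
  have hFi : Integrable F := (integrable_indicator_iff measurableSet_Ioo).2 hu
  have hVi : Integrable V := (integrable_indicator_iff measurableSet_Ioo).2 hv
  have hAi : Integrable A := integrable_fracKernel (b - a) hα0
  have hBi : Integrable B := integrable_fracKernel (b - a) hβ
  -- On `(a, b)`, `D` is `(c / Γ(α)) κ` and `W` is `I^α v`; unlike `κ` itself, `D` is integrable on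
  -- the whole line.
  set D : ℝ → ℝ := fun x => c * A (x - a) with hD
  have hDi : Integrable D := (hAi.comp_sub_right a).const_mul c
  set W := V ⋆[ContinuousLinearMap.mul ℝ ℝ] A with hW
  have hWi : Integrable W := hVi.integrable_convolution _ hAi
  have hV0 : ∀ y ≤ a, V y = 0 := fun y hy => indicator_of_notMem (fun h => hy.not_gt h.1) _
  have hG0 : ∀ y ≤ a, F y - D y - W y = 0 := by
    intro y hy
    have h1 : F y = 0 := indicator_of_notMem (fun h => hy.not_gt h.1) _
    have h2 : D y = 0 := by simp [hD, hA, fracKernel_of_nonpos (show y - a ≤ 0 by linarith)]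
    have h3 : W y = 0 := convolution_fracKernel_eq_zero hy (.of_forall fun z hz => hV0 z hz.le)
    rw [h1, h2, h3]; simp
  have hGi : Integrable (fun y => F y - D y - W y) := (hFi.sub hDi).sub hWi
  -- A translate by `a` of the identity that the two kernels convolve to `1` on `(0, b - a)`.
  have hDB : ∀ x ∈ Ioo a b, ∫ t, D t * B (x - t) = c := by
    intro x hx
    have h1 := convolution_fracKernel (L := b - a) hβ hα0 (by ring) (t := x - a)
      (by linarith [hx.2])
    rw [indicator_of_mem (by simpa using hx.1), convolution_mul,
      ← integral_sub_right_eq_self _ a] at h1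
    simp_rw [hD, mul_assoc, integral_const_mul]
    simp only [Pi.one_apply, sub_sub_sub_cancel_right] at h1
    rw [h1, mul_one]
  -- On `(a, b)` the three terms contribute `(c + ∫ₐˣ v) - c - ∫ₐˣ v`.
  have hGB : ∀ᵐ x, x < b →
      ((fun y => F y - D y - W y) ⋆[ContinuousLinearMap.mul ℝ ℝ] B) x = 0 := by
    filter_upwards [h, ae_convolution_fracKernel_convolution (a := a) (b := b) hβ hα0 (by ring)
      hVi hV0, hFi.ae_convolution_exists (ContinuousLinearMap.mul ℝ ℝ) hBi,
      hDi.ae_convolution_exists (ContinuousLinearMap.mul ℝ ℝ) hBi,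
      hWi.ae_convolution_exists (ContinuousLinearMap.mul ℝ ℝ) hBi] with x hx1 hx2 hx3 hx4 hx5 hxb
    rcases le_or_gt x a with hxa | hxa
    · exact convolution_fracKernel_eq_zero hxa (.of_forall fun z hz => hG0 z hz.le)
    · have hx : x ∈ Ioo a b := ⟨hxa, hxb⟩
      have e1 := hx1 hx
      have e2 := hx2 hx
      have e3 := hDB x hx
      have e4 : ∫ t in a..x, V t = ∫ t in a..x, v t := by
        refine intervalIntegral.integral_congr_ae (.of_forall fun t ht => ?_)
        rw [uIoc_of_le hxa.le] at ht
        exact indicator_of_mem (show t ∈ Ioo a b from ⟨ht.1, ht.2.trans_lt hxb⟩) _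
      rw [leftFracIntegral_eq_convolution hxb.le, convolution_mul] at e1
      rw [convolution_mul, e4] at e2
      rw [convolution_mul]
      simp_rw [sub_mul]
      have i3 : Integrable fun t => F t * B (x - t) := hx3
      have i4 : Integrable fun t => D t * B (x - t) := hx4
      have i5 : Integrable fun t => W t * B (x - t) := hx5
      have i34 : Integrable fun t => F t * B (x - t) - D t * B (x - t) := i3.sub i4
      rw [integral_sub i34 i5, integral_sub i3 i4, e1, e2, e3]
      ring
  -- Convolving once more, now with the order `α` kernel, turns the previous vanishing into that of
  -- the primitive.
  have hG : ∀ᵐ x, x ∈ Ioo a b → F x - D x - W x = 0 := by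
    refine ae_eq_zero_of_ae_primitive_eq_zero hab hGi ?_
    filter_upwards [ae_convolution_fracKernel_convolution (a := a) (b := b) hα0 hβ (by ring)
      hGi hG0] with x hx hxab
    rw [← hx hxab]
    exact convolution_fracKernel_eq_zero hxab.2.le hGB
  filter_upwards [hG] with x hx hxab
  have h1 := hx hxab
  have h2 : F x = u x := indicator_of_mem hxab _
  have h3 : D x = c / Real.Gamma α * leftKernel a α x := by
    have : x - a ∈ Ioo 0 (b - a) := ⟨by linarith [hxab.1], by linarith [hxab.2]⟩
    simp only [hD, hA, fracKernel, indicator_of_mem this, leftKernel]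
    ring
  rw [leftFracIntegral_eq_convolution hxab.2.le]
  linarith

/-! ### `L^p` bounds, traces and the left inequality -/

/-- The operator `I^σ` is bounded on `L^p(a, b)`, uniformly in `p`. -/
theorem eLpNorm_leftFracIntegral_le {a b σ : ℝ} (hσ : 0 < σ) {f : ℝ → ℝ}
    (hf : AEStronglyMeasurable f (volume.restrict (Ioo a b))) {p : ℝ≥0∞} (hp1 : 1 ≤ p)
    (hp : p ≠ ⊤) :
    eLpNorm (leftFracIntegral (Ioo a b) σ f) p (volume.restrict (Ioo a b)) ≤
      eLpNorm (fracKernel (b - a) σ) 1 volume * eLpNorm f p (volume.restrict (Ioo a b)) := by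
  have h1 : leftFracIntegral (Ioo a b) σ f =ᵐ[volume.restrict (Ioo a b)]
      (Ioo a b).indicator f ⋆[ContinuousLinearMap.mul ℝ ℝ] fracKernel (b - a) σ :=
    (ae_restrict_iff' measurableSet_Ioo).2
      (.of_forall fun x hx => leftFracIntegral_eq_convolution hx.2.le f)
  rw [eLpNorm_congr_ae h1, ← eLpNorm_indicator_eq_eLpNorm_restrict (f := f) measurableSet_Ioo]
  exact (eLpNorm_mono_measure _ Measure.restrict_le_self).trans (eLpNorm_convolution_le
    ((aestronglyMeasurable_indicator_iff measurableSet_Ioo).2 hf)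
    (integrable_fracKernel (b - a) hσ) hp1 hp)

theorem IsLeftWeakFracDeriv.exists_representation {a b α : ℝ} (hab : a < b) (hα1 : α < 1)
    {u v : ℝ → ℝ} (h : IsLeftWeakFracDeriv (Ioo a b) α u v) (hv : IntegrableOn v (Ioo a b)) :
    ∃ ℓ, ∀ᵐ x, x ∈ Ioo a b →
      leftFracIntegral (Ioo a b) (1 - α) u x = ℓ + ∫ t in a..x, v t :=
  ae_eq_const_add_primitive hab (integrableOn_leftFracIntegral (by linarith) h.1) hv
    fun φ hφ => by rw [h.2.2 φ hφ, integral_mul_rightRLDeriv hα1 h.1 hφ]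

theorem hasTrace_of_ae_eq_primitive {a b ℓ : ℝ} (hab : a < b) {w v : ℝ → ℝ}
    (hv : IntegrableOn v (Ioo a b))
    (h : ∀ᵐ x, x ∈ Ioo a b → w x = ℓ + ∫ t in a..x, v t) : HasTrace a b w a ℓ := by
  refine ⟨fun x => ℓ + ∫ t in a..x, v t, continuousOn_const.add ?_, ?_, by simp⟩
  · have := intervalIntegral.continuousOn_primitive_interval (f := v) (μ := volume) (a := a)
      (b := b) (by rw [uIcc_of_le hab.le]
                   exact (integrableOn_Icc_iff_integrableOn_Ioo (by simp) (by simp)).2 hv)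
    rwa [uIcc_of_le hab.le] at this
  · exact (ae_restrict_iff' measurableSet_Ioo).2 (h.mono fun x hx hxab => (hx hxab).symm)

/-- Continuous functions equal a.e. on the open interval agree there, and on its closure by density.
This identifies any admissible boundary value with the integration constant of the representation.
-/
theorem HasTrace.unique {a b t ℓ ℓ' : ℝ} {g : ℝ → ℝ} (hab : a < b) (ht : t ∈ Icc a b)
    (h : HasTrace a b g t ℓ) (h' : HasTrace a b g t ℓ') : ℓ = ℓ' := by
  obtain ⟨J, hJ, hJg, rfl⟩ := h
  obtain ⟨J', hJ', hJg', rfl⟩ := h'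
  have h1 : EqOn J J' (Ioo a b) := Measure.eqOn_open_of_ae_eq (hJg.trans hJg'.symm) isOpen_Ioo
    (hJ.mono Ioo_subset_Icc_self) (hJ'.mono Ioo_subset_Icc_self)
  exact h1.of_subset_closure hJ hJ' Ioo_subset_Icc_self (closure_Ioo hab.ne).ge ht

theorem MeasureTheory.MemLp.integrableOn_Ioo {a b : ℝ} {f : ℝ → ℝ} {p : ℝ≥0∞}
    (hf : MemLp f p (volume.restrict (Ioo a b))) (hp : 1 ≤ p) : IntegrableOn f (Ioo a b) :=
  hf.integrable hp

theorem exists_isLeftKernelConst {a b α : ℝ} (hab : a < b) (hα1 : α < 1) {p : ℝ≥0∞} (hp : 1 ≤ p)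
    {u : ℝ → ℝ} (hu : u ∈ leftFracSobolev (Ioo a b) α p) : ∃ c, IsLeftKernelConst a b α u c := by
  obtain ⟨-, v, hv, hvp⟩ := hu
  obtain ⟨ℓ, hℓ⟩ := hv.exists_representation hab hα1 (hvp.integrableOn_Ioo hp)
  exact ⟨_, ℓ, hasTrace_of_ae_eq_primitive hab (hvp.integrableOn_Ioo hp) hℓ, rfl⟩

/-- The left fractional Poincaré inequality. -/
theorem eLpNorm_sub_leftKernel_le {a b α C : ℝ} (hab : a < b) (hα0 : 0 < α) (hα1 : α < 1)
    (hC0 : 0 < C) (hC : eLpNorm (fracKernel (b - a) α) 1 volume ≤ ENNReal.ofReal C)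
    {p : ℝ≥0∞} (hp1 : 1 ≤ p) (hp : p ≠ ⊤) {u v : ℝ → ℝ} {c : ℝ}
    (hc : IsLeftKernelConst a b α u c) (h : IsLeftWeakFracDeriv (Ioo a b) α u v) :
    eLpNorm (fun x => u x - c * leftKernel a α x) p (volume.restrict (Ioo a b)) ≤
      ENNReal.ofReal C * eLpNorm v p (volume.restrict (Ioo a b)) := by
  have hvm : AEStronglyMeasurable v (volume.restrict (Ioo a b)) := h.2.1.aestronglyMeasurable
  -- An arbitrary weak derivative `v` is allowed, so its norm may be infinite a priori; the bound is
  -- then trivial because `C > 0`.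
  by_cases hvp : eLpNorm v p (volume.restrict (Ioo a b)) = ⊤
  · rw [hvp, ENNReal.mul_top (ENNReal.ofReal_pos.2 hC0).ne']
    exact le_top
  have hvi : IntegrableOn v (Ioo a b) :=
    MemLp.integrableOn_Ioo (p := p) ⟨hvm, lt_top_iff_ne_top.2 hvp⟩ hp1
  obtain ⟨ℓ, hℓ⟩ := h.exists_representation hab hα1 hvi
  obtain ⟨ℓ', hℓ', rfl⟩ := hc
  obtain rfl : ℓ' = ℓ := hℓ'.unique hab ⟨le_rfl, hab.le⟩ (hasTrace_of_ae_eq_primitive hab hvi hℓ)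
  rw [eLpNorm_congr_ae ((ae_restrict_iff' measurableSet_Ioo).2
    (ae_eq_kernel_add_leftFracIntegral hab hα0 hα1 h.1 hvi hℓ))]
  exact (eLpNorm_leftFracIntegral_le hα0 hvm hp1 hp).trans (mul_le_mul_left hC _)

/-! ### Reflection and the right inequality -/

theorem preimage_reflection_Ioo (a b : ℝ) : (fun x => a + b - x) ⁻¹' Ioo a b = Ioo a b := by
  ext x; simp only [mem_preimage, mem_Ioo]; constructor <;> rintro ⟨h1, h2⟩ <;>
    constructor <;> linarith

theorem measurePreserving_reflection_restrict_Ioo (a b : ℝ) :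
    MeasurePreserving (fun x => a + b - x) (volume.restrict (Ioo a b))
      (volume.restrict (Ioo a b)) := by
  have := (Measure.measurePreserving_sub_left volume (a + b)).restrict_preimage
    (measurableSet_Ioo (a := a) (b := b))
  rwa [preimage_reflection_Ioo] at this

theorem measurableEmbedding_sub_left (s : ℝ) : MeasurableEmbedding fun x : ℝ => s - x :=
  (MeasurableEquiv.subLeft s).measurableEmbedding

theorem setIntegral_comp_reflection (a b : ℝ) (f : ℝ → ℝ) :
    ∫ x in Ioo a b, f (a + b - x) = ∫ x in Ioo a b, f x :=
  (measurePreserving_reflection_restrict_Ioo a b).integral_comp (measurableEmbedding_sub_left _) f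

theorem eLpNorm_comp_reflection (a b : ℝ) (f : ℝ → ℝ) (p : ℝ≥0∞) :
    eLpNorm (fun x => f (a + b - x)) p (volume.restrict (Ioo a b)) =
      eLpNorm f p (volume.restrict (Ioo a b)) := by
  conv_rhs => rw [← (measurePreserving_reflection_restrict_Ioo a b).map_eq,
    (measurableEmbedding_sub_left _).eLpNorm_map_measure]
  rfl

/-- The substitution `y ↦ s - y`. A general `Ω` covers both `(a, b)`, for the fractional integrals
of `u`, and `ℝ`, for those of test functions. -/
theorem leftFracIntegral_comp_sub_left (s σ : ℝ) (Ω : Set ℝ) (hΩ : MeasurableSet Ω) (f : ℝ → ℝ)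
    (x : ℝ) :
    leftFracIntegral ((fun x => s - x) ⁻¹' Ω) σ (fun y => f (s - y)) x =
      rightFracIntegral Ω σ f (s - x) := by
  rw [leftFracIntegral, rightFracIntegral, ← integral_indicator (hΩ.inter measurableSet_Ioi),
    ← integral_indicator ((hΩ.preimage (by fun_prop)).inter measurableSet_Iio)]
  classical
  congr 1
  refine Eq.trans (integral_congr_ae (.of_forall fun y => ?_))
    (integral_sub_left_eq_self ((Ω ∩ Ioi (s - x)).indicator
      fun y => (y - (s - x)) ^ (σ - 1) * f y) volume s)
  simp only [indicator_apply, mem_inter_iff, mem_preimage, mem_Iio, mem_Ioi, sub_lt_sub_iff_left,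
    sub_sub_sub_cancel_left]

theorem leftFracIntegral_comp_reflection (a b σ : ℝ) (f : ℝ → ℝ) :
    leftFracIntegral (Ioo a b) σ (fun y => f (a + b - y)) =
      fun x => rightFracIntegral (Ioo a b) σ f (a + b - x) := by
  ext x
  rw [← leftFracIntegral_comp_sub_left _ _ _ measurableSet_Ioo, preimage_reflection_Ioo]

theorem leftRLDeriv_comp_sub_left (s α : ℝ) (φ : ℝ → ℝ) (x : ℝ) :
    leftRLDeriv α (fun y => φ (s - y)) x = rightRLDeriv α φ (s - x) := by
  have h : leftFracIntegral univ (1 - α) (fun y => φ (s - y)) =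
      fun x => rightFracIntegral univ (1 - α) φ (s - x) := by
    ext x
    rw [← leftFracIntegral_comp_sub_left _ _ _ MeasurableSet.univ, preimage_univ]
  rw [leftRLDeriv, h, deriv_comp_const_sub, rightRLDeriv]

theorem IsTestFunction.comp_reflection {a b : ℝ} {φ : ℝ → ℝ} (h : IsTestFunction (Ioo a b) φ) :
    IsTestFunction (Ioo a b) (fun x => φ (a + b - x)) := by
  refine ⟨h.1.comp (contDiff_const.sub contDiff_id),
    h.2.1.comp_homeomorph (Homeomorph.subLeft (a + b)), ?_⟩
  rw [← preimage_reflection_Ioo]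
  exact (tsupport_comp_subset_preimage φ (by fun_prop)).trans (preimage_mono h.2.2)

theorem integrableOn_comp_reflection {a b : ℝ} {f : ℝ → ℝ} (hf : IntegrableOn f (Ioo a b)) :
    IntegrableOn (fun x => f (a + b - x)) (Ioo a b) :=
  ((measurePreserving_reflection_restrict_Ioo a b).integrable_comp_emb
    (measurableEmbedding_sub_left _)).2 hf

theorem locallyIntegrableOn_comp_reflection {a b : ℝ} {f : ℝ → ℝ}
    (hf : LocallyIntegrableOn f (Ioo a b)) :
    LocallyIntegrableOn (fun x => f (a + b - x)) (Ioo a b) := by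
  rw [locallyIntegrableOn_iff isOpen_Ioo.isLocallyClosed] at hf ⊢
  intro K hK hKc
  have h1 : IsCompact ((fun x => a + b - x) ⁻¹' K) :=
    (Homeomorph.subLeft (a + b)).isClosedEmbedding.isCompact_preimage hKc
  have h2 := hf ((fun x => a + b - x) ⁻¹' K)
    (by rw [← preimage_reflection_Ioo a b]; exact preimage_mono hK) h1
  have h3 := ((Measure.measurePreserving_sub_left volume (a + b)).integrableOn_comp_preimage
    (measurableEmbedding_sub_left _)).2 h2
  have h4 : (fun x => a + b - x) ⁻¹' ((fun x => a + b - x) ⁻¹' K) = K := by ext; simp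
  rwa [h4] at h3

/-- Reflection preserves test functions and exchanges the two Riemann–Liouville derivatives, so a
change of variables in the defining identity suffices. -/
theorem IsRightWeakFracDeriv.comp_reflection {a b α : ℝ} {u v : ℝ → ℝ}
    (h : IsRightWeakFracDeriv (Ioo a b) α u v) :
    IsLeftWeakFracDeriv (Ioo a b) α (fun x => u (a + b - x)) (fun x => v (a + b - x)) := by
  refine ⟨integrableOn_comp_reflection h.1, locallyIntegrableOn_comp_reflection h.2.1,
    fun φ hφ => ?_⟩
  have h1 := h.2.2 _ hφ.comp_reflection
  rw [← setIntegral_comp_reflection, ← setIntegral_comp_reflection a b (fun x => u x * _)] at h1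
  simpa [leftRLDeriv_comp_sub_left] using h1

theorem comp_reflection_mem_leftFracSobolev {a b α : ℝ} {p : ℝ≥0∞} {u : ℝ → ℝ}
    (hu : u ∈ rightFracSobolev (Ioo a b) α p) :
    (fun x => u (a + b - x)) ∈ leftFracSobolev (Ioo a b) α p := by
  obtain ⟨hup, v, hv, hvp⟩ := hu
  have hR := measurePreserving_reflection_restrict_Ioo a b
  exact ⟨hup.comp_measurePreserving hR, _, hv.comp_reflection, hvp.comp_measurePreserving hR⟩

theorem HasTrace.comp_reflection {a b t ℓ : ℝ} {g : ℝ → ℝ} (h : HasTrace a b g t ℓ) :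
    HasTrace a b (fun x => g (a + b - x)) (a + b - t) ℓ := by
  obtain ⟨J, hJ, hJg, hJt⟩ := h
  refine ⟨fun x => J (a + b - x), hJ.comp (by fun_prop) fun x hx => ?_,
    (measurePreserving_reflection_restrict_Ioo a b).quasiMeasurePreserving.ae_eq_comp hJg,
    by simpa using hJt⟩
  constructor <;> linarith [hx.1, hx.2]

theorem isLeftKernelConst_comp_reflection {a b α c : ℝ} {u : ℝ → ℝ} :
    IsLeftKernelConst a b α (fun x => u (a + b - x)) c ↔ IsRightKernelConst a b α u c := by
  rw [IsLeftKernelConst, IsRightKernelConst, leftFracIntegral_comp_reflection]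
  refine exists_congr fun ℓ => and_congr_left fun _ => ⟨fun h => ?_, fun h => ?_⟩
  · simpa using h.comp_reflection
  · simpa using h.comp_reflection

theorem exists_isRightKernelConst {a b α : ℝ} (hab : a < b) (hα1 : α < 1) {p : ℝ≥0∞} (hp : 1 ≤ p)
    {u : ℝ → ℝ} (hu : u ∈ rightFracSobolev (Ioo a b) α p) : ∃ c, IsRightKernelConst a b α u c := by
  obtain ⟨c, hc⟩ := exists_isLeftKernelConst hab hα1 hp (comp_reflection_mem_leftFracSobolev hu)
  exact ⟨c, isLeftKernelConst_comp_reflection.1 hc⟩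

/-- The right fractional Poincaré inequality. -/
theorem eLpNorm_sub_rightKernel_le {a b α C : ℝ} (hab : a < b) (hα0 : 0 < α) (hα1 : α < 1)
    (hC0 : 0 < C) (hC : eLpNorm (fracKernel (b - a) α) 1 volume ≤ ENNReal.ofReal C)
    {p : ℝ≥0∞} (hp1 : 1 ≤ p) (hp : p ≠ ⊤) {u v : ℝ → ℝ} {c : ℝ}
    (hc : IsRightKernelConst a b α u c) (h : IsRightWeakFracDeriv (Ioo a b) α u v) :
    eLpNorm (fun x => u x - c * rightKernel b α x) p (volume.restrict (Ioo a b)) ≤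
      ENNReal.ofReal C * eLpNorm v p (volume.restrict (Ioo a b)) := by
  have key := eLpNorm_sub_leftKernel_le hab hα0 hα1 hC0 hC hp1 hp
    (isLeftKernelConst_comp_reflection.2 hc) h.comp_reflection
  rw [eLpNorm_comp_reflection a b v] at key
  rw [← eLpNorm_comp_reflection]
  -- The kernels match because `b - (a + b - x) = x - a`.
  convert key using 5 with x
  rw [rightKernel, leftKernel]
  congr 1; ring

theorem mainTheorem8 (a b α : ℝ) (hab : a < b) (hα0 : 0 < α) (hα1 : α < 1) :
    ∃ C : ℝ, 0 < C ∧ ∀ p : ℝ≥0∞, 1 ≤ p → p ≠ ⊤ →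
      (∀ u ∈ leftFracSobolev (Ioo a b) α p,
        (∃ c, IsLeftKernelConst a b α u c) ∧
        ∀ c, IsLeftKernelConst a b α u c → ∀ v, IsLeftWeakFracDeriv (Ioo a b) α u v →
          eLpNorm (fun x => u x - c * leftKernel a α x) p (volume.restrict (Ioo a b)) ≤
            ENNReal.ofReal C * eLpNorm v p (volume.restrict (Ioo a b))) ∧
      (∀ u ∈ rightFracSobolev (Ioo a b) α p,
        (∃ c, IsRightKernelConst a b α u c) ∧
        ∀ c, IsRightKernelConst a b α u c → ∀ v, IsRightWeakFracDeriv (Ioo a b) α u v →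
          eLpNorm (fun x => u x - c * rightKernel b α x) p (volume.restrict (Ioo a b)) ≤
            ENNReal.ofReal C * eLpNorm v p (volume.restrict (Ioo a b))) := by
  set N := eLpNorm (fracKernel (b - a) α) 1 volume with hN
  have hN_top : N ≠ ⊤ :=
    (memLp_one_iff_integrable.2 (integrable_fracKernel (b - a) hα0)).eLpNorm_ne_top
  -- Adding `1` makes the constant positive without a lower bound on the kernel's norm.
  have hC0 : 0 < N.toReal + 1 := by positivity
  have hC : N ≤ ENNReal.ofReal (N.toReal + 1) := by
    rw [← ENNReal.ofReal_toReal hN_top]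
    exact ENNReal.ofReal_le_ofReal (by simp [ENNReal.toReal_ofReal])
  refine ⟨N.toReal + 1, hC0, fun p hp1 hp => ⟨fun u hu =>
    ⟨exists_isLeftKernelConst hab hα1 hp1 hu, fun c hc v hv =>
      eLpNorm_sub_leftKernel_le hab hα0 hα1 hC0 hC hp1 hp hc hv⟩, fun u hu =>
    ⟨exists_isRightKernelConst hab hα1 hp1 hu, fun c hc v hv =>
      eLpNorm_sub_rightKernel_le hab hα0 hα1 hC0 hC hp1 hp hc hv⟩⟩⟩
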